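/- **Theorem.** Let $\Phi$ be an irreducible (reduced, crystallographic) root system of rank $\ell$ in a Euclidean space $V$, with a fixed set of simple roots $\Delta=\{\alpha_1,\dots,\alpha_\ell\}$ and corresponding positive roots $\Phi^+$. Let $h=1+c_1+\dots+c_\ell$ be its Coxeter number, where $c_1\alpha_1+\dots+c_\ell\alpha_\ell$ is the highest root. Let $L=\{x\in V\mid(\alpha_i,x)\in\mathbb Z,\ i=1,\dots,\ell\}$ be the coweight lattice. Let $k\ge 1$ be an integer and let $$\mathcal A=\mathcal A_\Phi^{[1-k,k]}=\{H_{\alpha,j}\mid\alpha\in\Phi^+,\ j\in\mathbb Z,\ 1-k\le j\le k\},\qquad H_{\alpha,j}=\{x\in V\mid(\alpha,x)=j\},$$ be the extended Shi arrangement. For a positive integer $q$ put $$M(\mathcal A;q)=\{\overline x\in L/qL\mid(\alpha,x)\not\equiv j \bmod q\ \text{ for all } H_{\alpha,j}\in\mathcal A\}.$$ A function $f:\mathbb Z\to\mathbb Z$ is a *quasi-polynomial with gcd-property* if there are an integer $n>0$ and polynomials $g_1,\dots,g_n\in\mathbb Z[t]$ such that $f(q)=g_r(q)$ whenever $q\equiv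 r\bmod n$ ($1\le r\le n$), and $g_r=g_s$ whenever $\gcd(r,n)=\gcd(s,n)$. The *characteristic quasi-polynomial* $\chi_{\mathrm{quasi}}(\mathcal A,t)$ is the unique quasi-polynomial with gcd-property such that $\#M(\mathcal A;q)=\chi_{\mathrm{quasi}}(\mathcal A,q)$ for all sufficiently large integers $q$. Then $\chi_{\mathrm{quasi}}(\mathcal A,t)$ exists, is unique, and is the polynomial $$\chi_{\mathrm{quasi}}(\mathcal A_\Phi^{[1-k,k]},t)=(t-kh)^\ell .$$ -/

import Mathlib

open Polynomial

noncomputable section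

/-! ### Quasi-polynomials -/

/-- `f : ℤ → ℤ` is a quasi-polynomial with gcd-property: there are `n > 0` and polynomials
`g₁, …, gₙ ∈ ℤ[t]` such that `f q = g_r q` whenever `q ≡ r mod n`, and `g_r` depends on `r` only
through `gcd (r, n)`. -/
def IsGcdQuasiPolynomial (f : ℤ → ℤ) : Prop :=
  ∃ n : ℕ, 0 < n ∧ ∃ g : ℕ → ℤ[X],
    (∀ r ∈ Finset.Icc 1 n, ∀ q : ℤ, q ≡ r [ZMOD n] → f q = (g r).eval q) ∧
    (∀ r ∈ Finset.Icc 1 n, ∀ s ∈ Finset.Icc 1 n, Nat.gcd r n = Nat.gcd s n → g r = g s)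

/-! ### Integral arrangements and their characteristic quasi-polynomials

An integral arrangement in a lattice `L` is given by a (finite) set of pairs `(α, k)` with
`α ∈ Hom(L, ℤ)` and `k ∈ ℤ`; the pair `(α, k)` stands for the affine hyperplane `α = k`. -/

/-- `M(A; q)`: the classes `x` in `L / qL` such that `α(x) ≢ k mod q` for all hyperplanes `(α, k)`
of the arrangement `A`. (The condition does not depend on the representative of the class.) -/
def complementMod {L : Type*} [AddCommGroup L] (A : Set (Module.Dual ℤ L × ℤ)) (q : ℕ) :
    Set (ModN L q) :=
  {y | ∀ x : L, ModN.mkQ q x = y → ∀ p ∈ A, ¬ p.1 x ≡ p.2 [ZMOD q]}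

/-- `χ` is the characteristic quasi-polynomial of the arrangement `A`: the quasi-polynomial with
gcd-property which agrees with the cardinality of `M(A; q)` for all sufficiently large `q`. -/
def IsCharQuasiPolynomial {L : Type*} [AddCommGroup L] (A : Set (Module.Dual ℤ L × ℤ))
    (χ : ℤ → ℤ) : Prop :=
  IsGcdQuasiPolynomial χ ∧
    ∃ q₀ : ℕ, ∀ q : ℕ, q₀ < q → ((complementMod A q).ncard : ℤ) = χ q

/-! ### Root systems

The ambient Euclidean space of the arrangements is the space `N` of the root pairing `P`, on which
the root `α` acts as the linear form `P.root' α`. (In a Euclidean space `V` containing the roots,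
this is the form `x ↦ (α, x)`.) -/

namespace RootPairing.Base

variable {ι M N : Type*} [AddCommGroup M] [Module ℝ M] [AddCommGroup N] [Module ℝ N]
  {P : RootPairing ι ℝ M N} (b : P.Base)

/-- The coweight lattice: the points at which all simple roots take integral values. -/
def coweightLattice : AddSubgroup N where
  carrier := {x | ∀ i ∈ b.support, ∃ m : ℤ, P.root' i x = m}
  zero_mem' i _ := ⟨0, by simp⟩
  add_mem' {x y} hx hy i hi := by
    obtain ⟨m, hm⟩ := hx i hi
    obtain ⟨n, hn⟩ := hy i hi
    exact ⟨m + n, by simp [hm, hn]⟩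
  neg_mem' {x} hx i hi := by
    obtain ⟨m, hm⟩ := hx i hi
    exact ⟨-m, by simp [hm]⟩

/-- Every root takes integral values on the coweight lattice. -/
theorem exists_int_root'_eq (i : ι) (x : b.coweightLattice) :
    ∃ m : ℤ, P.root' i (x : N) = m := by
  have key : ∀ v ∈ Submodule.span ℤ (P.root '' b.support),
      ∃ m : ℤ, P.toLinearMap v (x : N) = m := by
    intro v hv
    induction hv using Submodule.span_induction with
    | mem v hv =>
      obtain ⟨j, hj, rfl⟩ := hv
      exact x.2 j hj
    | zero => exact ⟨0, by simp⟩
    | add v w _ _ hv hw =>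
      obtain ⟨m, hm⟩ := hv
      obtain ⟨n, hn⟩ := hw
      exact ⟨m + n, by simp [hm, hn]⟩
    | smul c v _ hv =>
      obtain ⟨m, hm⟩ := hv
      exact ⟨c * m, by simp [hm]⟩
  exact key _ (b.root_mem_span_int i)

/-- The integral linear form on the coweight lattice given by a root. -/
def rootForm (i : ι) : Module.Dual ℤ b.coweightLattice :=
  (AddMonoidHom.mk' (fun x : b.coweightLattice ↦ (b.exists_int_root'_eq i x).choose) (by
    intro x y
    apply Int.cast_injective (α := ℝ)
    rw [Int.cast_add, ← (b.exists_int_root'_eq i (x + y)).choose_spec,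
      ← (b.exists_int_root'_eq i x).choose_spec, ← (b.exists_int_root'_eq i y).choose_spec,
      AddSubgroup.coe_add, map_add])).toIntLinearMap

theorem coe_rootForm_apply (i : ι) (x : b.coweightLattice) :
    (b.rootForm i x : ℝ) = P.root' i (x : N) :=
  (b.exists_int_root'_eq i x).choose_spec.symm

/-- The truncated affine Weyl arrangement `{H_{α, k} | α ∈ Φ⁺, a ≤ k ≤ c}`, as an integral
arrangement in the coweight lattice. -/
def truncatedAffineWeylArrangement (a c : ℤ) : Set (Module.Dual ℤ b.coweightLattice × ℤ) :=
  {p | ∃ i : ι, b.IsPos i ∧ ∃ k : ℤ, a ≤ k ∧ k ≤ c ∧ p = (b.rootForm i, k)}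

/-- The Coxeter number `h = 1 + c₁ + ⋯ + c_ℓ`, where `c₁ α₁ + ⋯ + c_ℓ α_ℓ` is the highest root.
(The highest root of an irreducible root system is the root of maximal height, and the height of
`∑ nᵢ αᵢ` is `∑ nᵢ`.) -/
def coxeterNumber [Fintype ι] : ℕ :=
  1 + Finset.univ.sup fun i ↦ (b.height i).toNat

end RootPairing.Base

end

noncomputable section

namespace RootPairing.Base

variable {ι M N : Type*} [AddCommGroup M] [Module ℝ M] [AddCommGroup N] [Module ℝ N]
  {P : RootPairing ι ℝ M N} (b : P.Base)

/-! ### Root forms and fundamental coweights -/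

/-! For q = m + kh with m > 0, the complement mod q is put in bijection with L/mL, which has m^ℓ
elements. Every x in L has x/m in exactly one partially closed alcove A (lower bound strict, upper
bound weak, for each positive root). The dilation hA has exactly one lattice point z in its
interior; for the fundamental alcove this is ρ^∨. Put F(x) = x + kz. Since α(z) is at least 1 away
from both bounding multiples of h, F(x) has margin k from the walls of qA, which says exactly that
it avoids the residues 1-k, …, k. Translating x by mv translates z by hv and F(x) by qv, so F
descends to L/mL → L/qL.

The harder half is surjectivity (`InAlcove.inShiAlcove_sub_smul`): subtracting kz from a point with
margin k must land in mA. Here z can be further than 1 from hyperplanes that are not walls, so only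
the walls of A give sharp bounds. One transports A to the fundamental alcove, where the walls are
the simple roots and the highest root θ, and deduces the other inequalities from these, keeping
track of which are strict (`rootForm_bounds_of_wall_bounds`).

The transport comes from minimising a distance (`exists_mem_fundamentalAlcove`). Finally, a
quasi-polynomial that agrees with a polynomial for large q equals it
(`IsGcdQuasiPolynomial.eq_eval`). -/

theorem rootForm_eq_sum_of_root_eq {i : ι} {f : ι → ℤ}
    (h : P.root i = ∑ j ∈ b.support, f j • P.root j) (x : b.coweightLattice) :
    b.rootForm i x = ∑ j ∈ b.support, f j * b.rootForm j x := by
  apply Int.cast_injective (α := ℝ)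
  push_cast
  simp only [coe_rootForm_apply, RootPairing.root', h, map_sum, LinearMap.sum_apply, map_zsmul,
    LinearMap.smul_apply, zsmul_eq_mul]

theorem rootForm_eq_add_of_root_eq {i j l : ι} (h : P.root i = P.root j + P.root l)
    (x : b.coweightLattice) : b.rootForm i x = b.rootForm j x + b.rootForm l x := by
  apply Int.cast_injective (α := ℝ)
  push_cast
  simp only [coe_rootForm_apply, RootPairing.root', h, map_add, LinearMap.add_apply]

theorem rootForm_eq_neg_of_root_eq {i j : ι} (h : P.root i = -P.root j)
    (x : b.coweightLattice) : b.rootForm i x = -b.rootForm j x := by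
  apply Int.cast_injective (α := ℝ)
  push_cast
  simp only [coe_rootForm_apply, RootPairing.root', h, map_neg, LinearMap.neg_apply]

theorem rootForm_reflectionPerm_self (i : ι) (x : b.coweightLattice) :
    b.rootForm (P.reflectionPerm i i) x = -b.rootForm i x :=
  b.rootForm_eq_neg_of_root_eq (by simp) x

section RootSystem

variable [P.IsRootSystem]

theorem exists_fundamentalCoweight (j : b.support) :
    ∃ x : N, ∀ i : ι, P.root' i x = b.toWeightBasis.coord j (P.root i) := by
  refine ⟨P.toLinearMap.flip.toPerfPair.symm (b.toWeightBasis.coord j), fun i ↦ ?_⟩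
  have := LinearEquiv.apply_symm_apply P.toLinearMap.flip.toPerfPair (b.toWeightBasis.coord j)
  exact LinearMap.congr_fun this (P.root i)

/-- The basis of the coweight lattice dual to the simple roots. -/
def fundamentalCoweight (j : b.support) : b.coweightLattice :=
  ⟨(b.exists_fundamentalCoweight j).choose, fun i hi ↦
    ⟨open Classical in if (⟨i, hi⟩ : b.support) = j then 1 else 0, by
      classical
      have h : b.toWeightBasis.repr (P.root i) = _ := b.toWeightBasis_repr_root ⟨i, hi⟩
      rw [(b.exists_fundamentalCoweight j).choose_spec, Module.Basis.coord_apply, h,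
        Finsupp.single_apply]
      split_ifs <;> simp⟩⟩

theorem rootForm_fundamentalCoweight [DecidableEq b.support] (i j : b.support) :
    b.rootForm i (b.fundamentalCoweight j) = if i = j then 1 else 0 := by
  apply Int.cast_injective (α := ℝ)
  rw [coe_rootForm_apply, fundamentalCoweight, (b.exists_fundamentalCoweight j).choose_spec]
  simp [Finsupp.single_apply]

theorem coweightLattice_ext {x y : b.coweightLattice}
    (h : ∀ j : b.support, b.rootForm j x = b.rootForm j y) : x = y := by
  apply Subtype.ext
  apply P.toLinearMap.flip.toPerfPair.injective
  apply b.toWeightBasis.ext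
  intro j
  have := congrArg (Int.cast : ℤ → ℝ) (h j)
  rw [coe_rootForm_apply, coe_rootForm_apply] at this
  simpa [RootPairing.root'] using this

/-- The coordinates on the coweight lattice given by the simple roots. -/
def coweightLatticeEquiv : b.coweightLattice ≃ₗ[ℤ] (b.support → ℤ) :=
  LinearEquiv.ofBijective (LinearMap.pi fun j : b.support ↦ b.rootForm j) <| by
    classical
    refine ⟨fun x y h ↦ b.coweightLattice_ext fun j ↦ congrFun h j, fun f ↦
      ⟨∑ j, f j • b.fundamentalCoweight j, ?_⟩⟩
    ext i
    simp [rootForm_fundamentalCoweight]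

theorem natCard_modN_coweightLattice {m : ℕ} (hm : 0 < m) :
    Nat.card (ModN b.coweightLattice m) = m ^ Module.finrank ℝ M := by
  have : NeZero m := ⟨hm.ne'⟩
  have : Module.Free ℤ b.coweightLattice := .of_equiv b.coweightLatticeEquiv.symm
  have : Module.Finite ℤ b.coweightLattice := .equiv b.coweightLatticeEquiv.symm
  rw [ModN.natCard_eq, b.coweightLatticeEquiv.finrank_eq,
    Module.finrank_eq_card_basis b.toWeightBasis]
  simp

/-- The coefficient of the simple root `j` in the root `i`. -/
def rootCoeff (i : ι) (j : b.support) : ℤ := b.rootForm i (b.fundamentalCoweight j)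

theorem rootForm_eq_sum (i : ι) (x : b.coweightLattice) :
    b.rootForm i x = ∑ j, b.rootCoeff i j * b.rootForm j x := by
  classical
  obtain ⟨f, -, -, h⟩ := b.exists_root_eq_sum_int i
  have h' (j : b.support) : b.rootCoeff i j = f j := by
    rw [rootCoeff, b.rootForm_eq_sum_of_root_eq h, ← Finset.sum_coe_sort]
    simp [rootForm_fundamentalCoweight]
  rw [b.rootForm_eq_sum_of_root_eq h, ← Finset.sum_coe_sort]
  simp [h']

theorem root_eq_sum (i : ι) : P.root i = ∑ j : b.support, b.rootCoeff i j • P.root j := by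
  classical
  obtain ⟨f, -, -, h⟩ := b.exists_root_eq_sum_int i
  have h' (j : b.support) : b.rootCoeff i j = f j := by
    rw [rootCoeff, b.rootForm_eq_sum_of_root_eq h, ← Finset.sum_coe_sort]
    simp [rootForm_fundamentalCoweight]
  rw [h, ← Finset.sum_coe_sort]
  simp [h']

theorem height_eq_sum_rootCoeff (i : ι) : b.height i = ∑ j, b.rootCoeff i j := by
  classical
  obtain ⟨f, -, -, h⟩ := b.exists_root_eq_sum_int i
  rw [height_eq_sum h, ← Finset.sum_coe_sort]
  refine Finset.sum_congr rfl fun j _ ↦ ?_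
  rw [rootCoeff, b.rootForm_eq_sum_of_root_eq h, ← Finset.sum_coe_sort]
  simp [rootForm_fundamentalCoweight]

/-- The sum of the fundamental coweights. -/
def coweightRho : b.coweightLattice := ∑ j, b.fundamentalCoweight j

theorem rootForm_coweightRho (i : ι) : b.rootForm i b.coweightRho = b.height i := by
  rw [coweightRho, map_sum, height_eq_sum_rootCoeff]
  rfl

variable {b} in
theorem IsPos.rootCoeff_nonneg {i : ι} (hi : b.IsPos i) (j : b.support) :
    0 ≤ b.rootCoeff i j := by
  classical
  obtain ⟨f, -, hf, h⟩ := b.exists_root_eq_sum_int i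
  have hf' : 0 ≤ f := by
    refine (hf.resolve_right fun hf ↦ ?_).le
    rw [isPos_iff, height_eq_sum h] at hi
    exact hi.not_ge (Finset.sum_nonpos fun j _ ↦ hf.le j)
  rw [rootCoeff, b.rootForm_eq_sum_of_root_eq h, ← Finset.sum_coe_sort]
  simpa [rootForm_fundamentalCoweight] using hf' j

theorem rootCoeff_self (j : b.support) : b.rootCoeff j j = 1 := by
  classical
  simp [rootCoeff, rootForm_fundamentalCoweight]

theorem pairingIn_eq_sum [P.IsCrystallographic] (i l : ι) :
    P.pairingIn ℤ i l = ∑ j : b.support, b.rootCoeff i j * P.pairingIn ℤ j l := by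
  apply FaithfulSMul.algebraMap_injective ℤ ℝ
  simp_rw [map_sum, map_mul, algebraMap_pairingIn]
  rw [← P.root_coroot_eq_pairing, b.root_eq_sum i]
  simp [map_sum]

end RootSystem

/-! ### The invariant form and the reflections on the coweight lattice -/

section Form

variable [Fintype ι]

theorem height_lt_coxeterNumber (i : ι) : b.height i < b.coxeterNumber := by
  have := Finset.le_sup (f := fun i ↦ (b.height i).toNat) (Finset.mem_univ i)
  rw [coxeterNumber]
  lia

/-- The invariant form `∑ α(x) α(y)`, the sum being over all roots. -/
def latticeForm (x y : b.coweightLattice) : ℤ := ∑ i, b.rootForm i x * b.rootForm i y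

theorem latticeForm_self_nonneg (x : b.coweightLattice) : 0 ≤ b.latticeForm x x :=
  Finset.sum_nonneg fun _ _ ↦ mul_self_nonneg _

theorem latticeForm_sub_smul (c : ℤ) (x y : b.coweightLattice) :
    b.latticeForm (x - c • y) (x - c • y) =
      b.latticeForm x x - 2 * c * b.latticeForm y x + c ^ 2 * b.latticeForm y y := by
  simp only [latticeForm, map_sub, map_zsmul, smul_eq_mul, Finset.mul_sum,
    ← Finset.sum_sub_distrib, ← Finset.sum_add_distrib]
  exact Finset.sum_congr rfl fun _ _ ↦ by ring

end Form

section Coroot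

variable [P.IsCrystallographic]

/-- The coroots belong to the coweight lattice. -/
def latticeCoroot (i : ι) : b.coweightLattice :=
  ⟨P.coroot i, fun j _ ↦ ⟨P.pairingIn ℤ j i, by
    rw [root'_coroot_eq_pairing, ← P.algebraMap_pairingIn ℤ]; rfl⟩⟩

theorem rootForm_latticeCoroot (i j : ι) :
    b.rootForm j (b.latticeCoroot i) = P.pairingIn ℤ j i := by
  apply Int.cast_injective (α := ℝ)
  rw [coe_rootForm_apply, latticeCoroot, root'_coroot_eq_pairing, ← P.algebraMap_pairingIn ℤ]
  rfl

theorem rootForm_reflectionPerm (i j : ι) (x : b.coweightLattice) :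
    b.rootForm (P.reflectionPerm i j) x =
      b.rootForm j x - P.pairingIn ℤ j i * b.rootForm i x := by
  have h : P.root (P.reflectionPerm i j) = P.root j - P.pairingIn ℤ j i • P.root i := by
    rw [root_reflectionPerm, reflection_apply_root' ℤ]
  apply Int.cast_injective (α := ℝ)
  push_cast
  simp only [coe_rootForm_apply, RootPairing.root', h, map_sub, LinearMap.sub_apply, map_zsmul,
    LinearMap.smul_apply, zsmul_eq_mul]

/-- The reflection in a root, on the coweight lattice. -/
def latticeReflection (i : ι) : b.coweightLattice ≃+ b.coweightLattice :=
  have hinv : Function.Involutive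
      (fun x : b.coweightLattice ↦ x - b.rootForm i x • b.latticeCoroot i) := fun x ↦ by
    simp only [map_sub, map_zsmul, rootForm_latticeCoroot, pairingIn_same, smul_eq_mul]
    module
  { hinv.toPerm with
    map_add' := fun x y ↦ by
      change x + y - _ = (x - _) + (y - _)
      rw [map_add]
      module }

theorem latticeReflection_apply (i : ι) (x : b.coweightLattice) :
    b.latticeReflection i x = x - b.rootForm i x • b.latticeCoroot i := rfl

theorem latticeReflection_latticeReflection (i : ι) (x : b.coweightLattice) :
    b.latticeReflection i (b.latticeReflection i x) = x := by
  simp only [latticeReflection_apply, map_sub, map_zsmul, rootForm_latticeCoroot, pairingIn_same]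
  module

theorem rootForm_latticeReflection (i j : ι) (x : b.coweightLattice) :
    b.rootForm j (b.latticeReflection i x) = b.rootForm (P.reflectionPerm i j) x := by
  rw [latticeReflection_apply, rootForm_reflectionPerm, map_sub, map_zsmul,
    rootForm_latticeCoroot, smul_eq_mul, mul_comm]

theorem rootForm_reflectionPerm_latticeReflection (i j : ι) (x : b.coweightLattice) :
    b.rootForm (P.reflectionPerm i j) (b.latticeReflection i x) = b.rootForm j x := by
  rw [rootForm_latticeReflection, reflectionPerm_self]

variable [Fintype ι]

theorem latticeForm_latticeCoroot_pos (i : ι) :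
    0 < b.latticeForm (b.latticeCoroot i) (b.latticeCoroot i) := by
  refine Finset.sum_pos' (fun _ _ ↦ mul_self_nonneg _) ⟨i, Finset.mem_univ _, ?_⟩
  simp [rootForm_latticeCoroot]

theorem latticeForm_latticeReflection (i : ι) (x y : b.coweightLattice) :
    b.latticeForm (b.latticeReflection i x) (b.latticeReflection i y) = b.latticeForm x y := by
  simp only [latticeForm, rootForm_latticeReflection]
  exact Equiv.sum_comp (P.reflectionPerm i) fun j ↦ b.rootForm j x * b.rootForm j y

/-- Invariance of the form under the reflection, which negates its own coroot. This makes the coroot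
orthogonal to the root hyperplane, so that reflecting changes distances in a computable way. -/
theorem two_mul_latticeForm_latticeCoroot (i : ι) (x : b.coweightLattice) :
    2 * b.latticeForm (b.latticeCoroot i) x =
      b.latticeForm (b.latticeCoroot i) (b.latticeCoroot i) * b.rootForm i x := by
  have h := b.latticeForm_latticeReflection i (b.latticeCoroot i) x
  have h1 : b.latticeReflection i (b.latticeCoroot i) = -b.latticeCoroot i := by
    rw [latticeReflection_apply, rootForm_latticeCoroot, pairingIn_same]
    module
  have h2 : b.latticeForm (-b.latticeCoroot i) (b.latticeReflection i x) =
      -b.latticeForm (b.latticeCoroot i) x +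
        b.latticeForm (b.latticeCoroot i) (b.latticeCoroot i) * b.rootForm i x := by
    simp only [latticeForm, latticeReflection_apply, map_neg, map_sub, map_zsmul, smul_eq_mul,
      Finset.sum_mul, ← Finset.sum_neg_distrib, ← Finset.sum_add_distrib]
    exact Finset.sum_congr rfl fun _ _ ↦ by ring
  rw [h1, h2] at h
  linarith

end Coroot

/-! ### The highest root -/

section Highest

variable [Fintype ι] [P.IsRootSystem] [P.IsCrystallographic]

theorem pairingIn_nonneg_of_forall_root_add_ne {i : ι} (hi : b.IsPos i) {j : ι}
    (hj : j ∈ b.support) (h : ∀ l, P.root l ≠ P.root i + P.root j) : 0 ≤ P.pairingIn ℤ i j := by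
  by_contra! hlt
  obtain ⟨l, hl⟩ := P.root_add_root_mem_of_pairingIn_neg hlt fun heq ↦ by
    have h1 := b.rootForm_eq_neg_of_root_eq heq b.coweightRho
    rw [rootForm_coweightRho, rootForm_coweightRho, height_one_of_mem_support hj] at h1
    rw [isPos_iff] at hi
    lia
  exact h l hl

/-- The support spreads along the connected Dynkin diagram: if `l` is in the support and its
neighbour `m` is not, the root pairs negatively with `m`, so adding the simple root `m` would give a
root. -/
theorem rootCoeff_pos_of_forall_root_add_ne [P.IsReduced] [P.IsIrreducible] {i : ι}
    (hi : b.IsPos i) (h : ∀ j ∈ b.support, ∀ l, P.root l ≠ P.root i + P.root j) (j : b.support) :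
    0 < b.rootCoeff i j := by
  obtain ⟨j₀, hj₀⟩ : ∃ j, 0 < b.rootCoeff i j := by
    by_contra! hle
    rw [isPos_iff, height_eq_sum_rootCoeff] at hi
    exact hi.not_ge (Finset.sum_nonpos fun j _ ↦ hle j)
  refine b.induction_on_cartanMatrix (fun j ↦ 0 < b.rootCoeff i j) hj₀ fun l m hl hlm ↦ ?_
  by_contra! hm
  have hm' : b.rootCoeff i m = 0 := le_antisymm hm (hi.rootCoeff_nonneg m)
  have hml : l ≠ m := by rintro rfl; lia
  have h0 := b.pairingIn_nonneg_of_forall_root_add_ne hi m.2 (h m m.2)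
  have hneg (n : b.support) (hn : n ≠ m) : P.pairingIn ℤ n m ≤ 0 :=
    b.pairingIn_le_zero_of_ne (fun h ↦ hn (Subtype.ext h)) n.2 m.2
  rw [b.pairingIn_eq_sum] at h0
  refine h0.not_gt (Finset.sum_neg' (fun n _ ↦ ?_) ⟨l, Finset.mem_univ _, ?_⟩)
  · rcases eq_or_ne n m with rfl | hn
    · simp [hm']
    · exact mul_nonpos_of_nonneg_of_nonpos (hi.rootCoeff_nonneg n) (hneg n hn)
  · refine mul_neg_of_pos_of_neg hl (lt_of_le_of_ne (hneg l hml) ?_)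
    rwa [ne_eq, cartanMatrix_apply_eq_zero_iff_symm] at hlm

theorem exists_highestRoot [P.IsReduced] [P.IsIrreducible] :
    ∃ θ, b.IsPos θ ∧ (∀ i j, b.rootCoeff i j ≤ b.rootCoeff θ j) ∧
      (b.coxeterNumber : ℤ) = 1 + b.height θ := by
  have : Nontrivial M := IsIrreducible.nontrivial P
  have : Nonempty ι := by
    by_contra hne
    rw [not_nonempty_iff] at hne
    have h := IsRootSystem.span_root_eq_top (P := P)
    rw [Set.range_eq_empty, Submodule.span_empty] at h
    exact bot_ne_top h
  obtain ⟨j₁, hj₁⟩ := b.support_nonempty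
  obtain ⟨θ, -, hθ⟩ := Finset.exists_max_image Finset.univ b.height Finset.univ_nonempty
  have hθpos : b.IsPos θ := by
    have := hθ j₁ (Finset.mem_univ _)
    rw [height_one_of_mem_support hj₁] at this
    rw [isPos_iff]
    lia
  have hθadd (j) (hj : j ∈ b.support) (l) : P.root l ≠ P.root θ + P.root j := fun h ↦ by
    have := hθ l (Finset.mem_univ _)
    rw [b.height_add h, height_one_of_mem_support hj] at this
    lia
  have hθcoeff := b.rootCoeff_pos_of_forall_root_add_ne hθpos hθadd
  refine ⟨θ, hθpos, fun i ↦ ?_, ?_⟩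
  · by_cases hi : b.IsPos i
    swap
    · intro j
      have h1 := (IsPos.or_neg b i).resolve_left hi
      have h2 := h1.rootCoeff_nonneg j
      have h3 : b.rootCoeff (P.reflectionPerm i i) j = -b.rootCoeff i j :=
        b.rootForm_reflectionPerm_self i _
      have h4 := hθcoeff j
      change 0 ≤ b.rootCoeff (P.reflectionPerm i i) j at h2
      lia
    classical
    -- Climb from `i` to a dominating root `γ` that no simple root can raise; it then suffices to
    -- compare `γ` with `θ`.
    obtain ⟨γ, hγ, hγmax⟩ := Finset.exists_max_image
      (Finset.univ.filter fun γ ↦ ∀ j, b.rootCoeff i j ≤ b.rootCoeff γ j) b.height ⟨i, by simp⟩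
    simp only [Finset.mem_filter, Finset.mem_univ, true_and] at hγ hγmax
    have hγpos : b.IsPos γ := by
      rw [isPos_iff, height_eq_sum_rootCoeff] at hi ⊢
      exact hi.trans_le (Finset.sum_le_sum fun j _ ↦ hγ j)
    have hγadd (j) (hj : j ∈ b.support) (l) : P.root l ≠ P.root γ + P.root j := fun h ↦ by
      have := hγmax l fun n ↦ by
        have h1 : b.rootCoeff l n = b.rootCoeff γ n + b.rootCoeff j n :=
          b.rootForm_eq_add_of_root_eq h _
        have h2 := (isPos_of_mem_support hj).rootCoeff_nonneg n
        have h3 := hγ n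
        lia
      rw [b.height_add h, height_one_of_mem_support hj] at this
      lia
    rcases eq_or_ne θ γ with rfl | hne
    · exact hγ
    -- `γ` is dominant and pairs positively with some simple root, while `θ` has full support. Hence
    -- `θ - γ` is a root, positive because `θ` has maximal height.
    have hpair : 0 < P.pairingIn ℤ θ γ := by
      obtain ⟨j, hj, hjγ⟩ := hγpos.exists_mem_support_pos_pairingIn
      rw [b.pairingIn_eq_sum]
      refine Finset.sum_pos' (fun n _ ↦ mul_nonneg (hθpos.rootCoeff_nonneg n) ?_)
        ⟨⟨j, hj⟩, Finset.mem_univ _, mul_pos (hθcoeff _) hjγ⟩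
      have := b.pairingIn_nonneg_of_forall_root_add_ne hγpos n.2 (hγadd n n.2)
      contrapose! this
      exact (P.pairingIn_lt_zero_iff ℤ).1 this
    obtain ⟨δ, hδ⟩ := P.root_sub_root_mem_of_pairingIn_pos hpair hne
    have hδpos : b.IsPos δ := by
      rw [isPos_iff', b.height_sub hδ]
      linarith [hθ γ (Finset.mem_univ _)]
    intro j
    have h1 : b.rootCoeff θ j = b.rootCoeff γ j + b.rootCoeff δ j :=
      b.rootForm_eq_add_of_root_eq (by rw [hδ]; abel) _
    linarith [hγ j, hδpos.rootCoeff_nonneg j]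
  · have : (Finset.univ.sup fun i ↦ (b.height i).toNat) = (b.height θ).toNat :=
      le_antisymm (Finset.sup_le fun i hi ↦ Int.toNat_le_toNat (hθ i hi))
        (Finset.le_sup (f := fun i ↦ (b.height i).toNat) (Finset.mem_univ θ))
    rw [coxeterNumber, this]
    rw [isPos_iff] at hθpos
    lia

end Highest

/-! ### Alcoves -/

/-- The permutation `σ` of the roots is induced by the automorphism `w` of the coweight lattice. -/
def IsInducedPerm (σ : Equiv.Perm ι) (w : b.coweightLattice ≃+ b.coweightLattice) : Prop :=
  ∀ i z, b.rootForm (σ i) (w z) = b.rootForm i z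

/-- The point `x / n` lies in the open alcove with address `κ`. -/
def InAlcove (κ : ι → ℤ) (n : ℤ) (x : b.coweightLattice) : Prop :=
  ∀ i, n * κ i < b.rootForm i x ∧ b.rootForm i x < n * (κ i + 1)

/-- The point `x` lies in the `n`-th dilation of the alcove with address `κ`, at distance at least
`k` from the walls, in the sense appropriate for the interval `[1 - k, k]`. For `k = 0`, this is
a partially closed alcove. -/
def InShiAlcove (κ : ι → ℤ) (n k : ℤ) (x : b.coweightLattice) : Prop :=
  ∀ i, b.IsPos i → n * κ i + k < b.rootForm i x ∧ b.rootForm i x ≤ n * (κ i + 1) - k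

variable {b}

theorem InAlcove.not_dvd {κ : ι → ℤ} {n : ℤ} (hn : 0 < n) {x : b.coweightLattice}
    (h : b.InAlcove κ n x) (i : ι) : ¬ n ∣ b.rootForm i x := by
  rintro ⟨c, hc⟩
  have h1 := h i
  rw [hc] at h1
  have h2 := lt_of_mul_lt_mul_left h1.1 hn.le
  have h3 := lt_of_mul_lt_mul_left h1.2 hn.le
  lia

theorem InAlcove.add_smul {κ : ι → ℤ} {n : ℤ} {x : b.coweightLattice} (h : b.InAlcove κ n x)
    (v : b.coweightLattice) : b.InAlcove (fun i ↦ κ i + b.rootForm i v) n (x + n • v) := fun i ↦ by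
  have := h i
  simp only [map_add, map_zsmul, smul_eq_mul]
  constructor <;> linarith

theorem InAlcove.apply_reflectionPerm_self {κ : ι → ℤ} {n : ℤ} (hn : 0 < n)
    {x : b.coweightLattice} (h : b.InAlcove κ n x) (i : ι) :
    κ (P.reflectionPerm i i) = -κ i - 1 := by
  have h1 := h i
  have h2 := h (P.reflectionPerm i i)
  rw [rootForm_reflectionPerm_self] at h2
  have h3 : κ i < -κ (P.reflectionPerm i i) := lt_of_mul_lt_mul_left (by linarith) hn.le
  have h4 : -κ (P.reflectionPerm i i) < κ i + 2 := lt_of_mul_lt_mul_left (by linarith) hn.le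
  lia

variable (b)

theorem isPos_reflectionPerm_self_iff (i : ι) :
    b.IsPos (P.reflectionPerm i i) ↔ ¬ b.IsPos i :=
  IsPos.neg_iff_not b i

theorem coxeterNumber_pos [Fintype ι] : 0 < b.coxeterNumber := by
  rw [coxeterNumber]
  positivity

/-- By integrality the strict bounds on `z` leave a gap of at least 1 on each side; adding `k`
copies of `z` turns it into a margin `k`. -/
theorem InAlcove.inShiAlcove_add_smul [Fintype ι] {κ : ι → ℤ} {m k : ℤ} (hk : 0 ≤ k)
    {x z : b.coweightLattice} (hz : b.InAlcove κ b.coxeterNumber z)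
    (hx : b.InShiAlcove κ m 0 x) :
    b.InShiAlcove κ (m + k * b.coxeterNumber) k (x + k • z) := fun i hi ↦ by
  have h1 := hz i
  have h2 := hx i hi
  have h3 : k * (b.coxeterNumber * κ i + 1) ≤ k * b.rootForm i z :=
    mul_le_mul_of_nonneg_left h1.1 hk
  have h4 : k * (b.rootForm i z + 1) ≤ k * (b.coxeterNumber * (κ i + 1)) :=
    mul_le_mul_of_nonneg_left h1.2 hk
  rw [map_add, map_zsmul, smul_eq_mul]
  constructor <;> linarith

theorem sum_mul_pos_of_sum_mul_pos {α : Type*} [Fintype α] {c f g : α → ℤ} (hc : ∀ i, 0 ≤ c i)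
    (hf : ∀ i, 0 ≤ f i) (hfg : ∀ i, 0 < g i → 0 < f i) (h : 0 < ∑ i, c i * g i) :
    0 < ∑ i, c i * f i := by
  obtain ⟨i, -, hi⟩ := Finset.exists_lt_of_sum_lt (s := Finset.univ) (f := fun _ : α ↦ (0 : ℤ))
    (by simpa using h)
  have hgi : 0 < g i := pos_of_mul_pos_right hi (hc i)
  have hci : 0 < c i := pos_of_mul_pos_left hi hgi.le
  exact Finset.sum_pos' (fun j _ ↦ mul_nonneg (hc j) (hf j))
    ⟨i, Finset.mem_univ _, mul_pos hci (hfg i hgi)⟩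

/-- Bounds at the walls of the fundamental alcove propagate to all positive roots. -/
theorem rootForm_bounds_of_wall_bounds [P.IsRootSystem] {θ : ι}
    (hθmax : ∀ i j, b.rootCoeff i j ≤ b.rootCoeff θ j) {m : ℤ} {y g : b.coweightLattice}
    (hy : ∀ j : b.support, 0 ≤ b.rootForm j y)
    (hyg : ∀ j : b.support, 0 < b.rootForm j g → 0 < b.rootForm j y)
    (hyθ : b.rootForm θ y ≤ m) (hygθ : b.rootForm θ g ≤ 0 → b.rootForm θ y < m)
    {i : ι} (hi : b.IsPos i) :
    (0 < b.rootForm i g → 0 < b.rootForm i y ∧ b.rootForm i y ≤ m) ∧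
      (b.rootForm i g ≤ 0 → 0 ≤ b.rootForm i y ∧ b.rootForm i y < m) := by
  have hsub (x : b.coweightLattice) : b.rootForm θ x - b.rootForm i x =
      ∑ j, (b.rootCoeff θ j - b.rootCoeff i j) * b.rootForm j x := by
    simp only [b.rootForm_eq_sum θ x, b.rootForm_eq_sum i x, sub_mul, Finset.sum_sub_distrib]
  have hle : b.rootForm i y ≤ b.rootForm θ y := by
    rw [← sub_nonneg, hsub]
    exact Finset.sum_nonneg fun j _ ↦ mul_nonneg (sub_nonneg.2 (hθmax i j)) (hy j)
  refine ⟨fun hg ↦ ⟨?_, hle.trans hyθ⟩, fun hg ↦ ⟨?_, ?_⟩⟩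
  · rw [rootForm_eq_sum] at hg ⊢
    exact sum_mul_pos_of_sum_mul_pos hi.rootCoeff_nonneg hy hyg hg
  · rw [rootForm_eq_sum]
    exact Finset.sum_nonneg fun j _ ↦ mul_nonneg (hi.rootCoeff_nonneg j) (hy j)
  · rcases le_or_gt (b.rootForm θ g) 0 with h | h
    · exact hle.trans_lt (hygθ h)
    -- Some simple root positive on `g` occurs in `θ - α_i`; it is positive on `y`, so `α_i(y) <
    -- θ(y)`.
    · have h1 : 0 < b.rootForm θ g - b.rootForm i g := by linarith
      rw [hsub] at h1
      have h2 := sum_mul_pos_of_sum_mul_pos (fun j ↦ sub_nonneg.2 (hθmax i j)) hy hyg h1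
      rw [← hsub] at h2
      linarith

/-! ### Moving an alcove to the fundamental one -/

variable [Fintype ι] [P.IsRootSystem] [P.IsCrystallographic]

/-- A variant of the statement that the affine Weyl group acts transitively on the alcoves. -/
theorem exists_mem_fundamentalAlcove {n : ℤ} (hn : 0 < n) {x : b.coweightLattice}
    (hx : ∀ i, ¬ n ∣ b.rootForm i x) :
    ∃ σ w, b.IsInducedPerm σ w ∧ ∃ t y, x = w y + n • t ∧
      ∀ i, b.IsPos i → 0 < b.rootForm i y ∧ b.rootForm i y < n := by
  let O : Set b.coweightLattice :=
    {y | ∃ σ w, b.IsInducedPerm σ w ∧ ∃ t, x = w y + n • t}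
  -- A multiple of the vector from `ρ^∨ / h` to `y / n`; its norm is minimised over the orbit.
  let u (y : b.coweightLattice) : b.coweightLattice :=
    (b.coxeterNumber : ℤ) • y - n • b.coweightRho
  have hO : O.Nonempty := ⟨x, Equiv.refl ι, AddEquiv.refl _, fun _ _ ↦ rfl, 0, by simp⟩
  obtain ⟨y, hyO, hmin⟩ : ∃ y ∈ O, ∀ z ∈ O,
      b.latticeForm (u y) (u y) ≤ b.latticeForm (u z) (u z) := by
    obtain ⟨y, hyO, hy⟩ := exists_minimalFor_of_wellFoundedLT (· ∈ O)
      (fun y ↦ (b.latticeForm (u y) (u y)).toNat) hO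
    refine ⟨y, hyO, fun z hz ↦ ?_⟩
    have h1 := b.latticeForm_self_nonneg (u y)
    have h2 := b.latticeForm_self_nonneg (u z)
    rcases le_total (b.latticeForm (u y) (u y)) (b.latticeForm (u z) (u z)) with h | h
    · exact h
    · have := hy hz (Int.toNat_le_toNat h)
      simp only at this
      lia
  have hnd (i) : ¬ n ∣ b.rootForm i y := by
    obtain ⟨σ, w, hσ, t, rfl⟩ := hyO
    intro hd
    apply hx (σ i)
    rw [map_add, hσ, map_zsmul, smul_eq_mul]
    exact dvd_add hd (dvd_mul_right _ _)
  -- At a minimiser, `y / n` and `ρ^∨ / h` are never strictly separated by a hyperplane `α_i = c`,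
  -- since reflecting `y / n` in it would shorten the distance. Only `c = 0` and `c = 1` are used.
  have key (i : ι) (c : ℤ) :
      0 ≤ (b.rootForm i y - n * c) * (b.height i - b.coxeterNumber * c) := by
    set d := b.rootForm i y - n * c with hd
    have hzO : y - d • b.latticeCoroot i ∈ O := by
      obtain ⟨σ, w, hσ, t, ht⟩ := hyO
      refine ⟨(P.reflectionPerm i).trans σ, (b.latticeReflection i).trans w, fun j z ↦ ?_,
        t - c • w (b.latticeReflection i (b.latticeCoroot i)), ?_⟩
      · rw [Equiv.trans_apply, AddEquiv.trans_apply, hσ,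
          rootForm_reflectionPerm_latticeReflection]
      · have hy : y - d • b.latticeCoroot i =
            b.latticeReflection i y + (n * c) • b.latticeCoroot i := by
          rw [latticeReflection_apply, hd]
          module
        rw [AddEquiv.trans_apply, hy, map_add, latticeReflection_latticeReflection, map_add,
          map_zsmul, map_zsmul, ht]
        module
    have h := hmin _ hzO
    have hu : u (y - d • b.latticeCoroot i) =
        u y - (b.coxeterNumber * d) • b.latticeCoroot i := by
      simp only [u]
      module
    have h1 := b.two_mul_latticeForm_latticeCoroot i (u y)
    have h2 : b.rootForm i (u y) = b.coxeterNumber * b.rootForm i y - n * b.height i := by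
      simp [u, rootForm_coweightRho]
    rw [h2] at h1
    have h3 := b.latticeForm_latticeCoroot_pos i
    have h4 : (0 : ℤ) < b.coxeterNumber := by
      rw [coxeterNumber]
      positivity
    rw [hu, b.latticeForm_sub_smul _ (u y)] at h
    have h5 : 0 ≤ (b.latticeForm (b.latticeCoroot i) (b.latticeCoroot i) * b.coxeterNumber * n) *
        (d * (b.height i - b.coxeterNumber * c)) := by
      have h6 : b.rootForm i y = d + n * c := by rw [hd]; ring
      rw [h6] at h1
      linear_combination h - (b.coxeterNumber * d) * h1
    exact nonneg_of_mul_nonneg_right h5 (by positivity)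
  obtain ⟨σ, w, hσ, t, ht⟩ := hyO
  refine ⟨σ, w, hσ, t, y, ht, fun i hi ↦ ?_⟩
  rw [isPos_iff] at hi
  have hlt := b.height_lt_coxeterNumber i
  have h0 := key i 0
  have h1 := key i 1
  have hn0 : b.rootForm i y ≠ 0 := fun h ↦ hnd i (h ▸ dvd_zero n)
  have hnn : b.rootForm i y ≠ n := fun h ↦ hnd i (h ▸ dvd_refl n)
  constructor
  · refine lt_of_le_of_ne ?_ hn0.symm
    exact nonneg_of_mul_nonneg_left (by simpa using h0) hi
  · refine lt_of_le_of_ne ?_ hnn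
    by_contra! hlt'
    nlinarith

/-- The alcove is `w` of the fundamental alcove, translated by `t`. The `-1` arises because a
negative root takes values in `(-1, 0)` on the fundamental alcove. -/
theorem InAlcove.exists_transport {κ : ι → ℤ} {n : ℤ} (hn : 0 < n) {x : b.coweightLattice}
    (hx : b.InAlcove κ n x) :
    ∃ σ w, b.IsInducedPerm σ w ∧ ∃ t : b.coweightLattice,
      (∀ i, b.IsPos i → κ (σ i) = b.rootForm (σ i) t) ∧
      ∀ i, ¬ b.IsPos i → κ (σ i) = b.rootForm (σ i) t - 1 := by
  obtain ⟨σ, w, hσ, t, y, rfl, hy⟩ := b.exists_mem_fundamentalAlcove hn (hx.not_dvd hn)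
  have hform (i) : b.rootForm (σ i) (w y + n • t) = b.rootForm i y + n * b.rootForm (σ i) t := by
    rw [map_add, hσ, map_zsmul, smul_eq_mul]
  refine ⟨σ, w, hσ, t, fun i hi ↦ ?_, fun i hi ↦ ?_⟩
  · have h1 := hx (σ i)
    rw [hform] at h1
    have h2 := hy i hi
    have h3 : κ (σ i) < b.rootForm (σ i) t + 1 := lt_of_mul_lt_mul_left (by linarith) hn.le
    have h4 : b.rootForm (σ i) t < κ (σ i) + 1 := lt_of_mul_lt_mul_left (by linarith) hn.le
    lia
  · have h1 := hx (σ i)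
    rw [hform] at h1
    have h2 := hy _ ((IsPos.or_neg b i).resolve_left hi)
    change 0 < b.rootForm (P.reflectionPerm i i) y ∧ b.rootForm (P.reflectionPerm i i) y < n at h2
    rw [rootForm_reflectionPerm_self] at h2
    have h3 : κ (σ i) < b.rootForm (σ i) t := lt_of_mul_lt_mul_left (by linarith) hn.le
    have h4 : b.rootForm (σ i) t < κ (σ i) + 2 := lt_of_mul_lt_mul_left (by linarith) hn.le
    lia

theorem InAlcove.exists_center {κ : ι → ℤ} {n : ℤ} (hn : 0 < n) {x : b.coweightLattice}
    (hx : b.InAlcove κ n x) : ∃ z, b.InAlcove κ b.coxeterNumber z := by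
  obtain ⟨σ, w, hσ, t, hpos, hneg⟩ := hx.exists_transport b hn
  refine ⟨w b.coweightRho + (b.coxeterNumber : ℤ) • t, fun i ↦ ?_⟩
  obtain ⟨i, rfl⟩ := σ.surjective i
  rw [map_add, hσ, map_zsmul, smul_eq_mul, rootForm_coweightRho]
  have h1 := b.height_lt_coxeterNumber i
  by_cases hi : b.IsPos i
  · rw [hpos i hi]
    rw [isPos_iff] at hi
    constructor <;> linarith
  · rw [hneg i hi]
    have h2 := b.height_lt_coxeterNumber (P.reflectionPerm i i)
    have h3 := (b.isPos_reflectionPerm_self_iff i).2 hi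
    have h4 : b.height (P.reflectionPerm i i) = -b.height i := b.height_reflectionPerm_self i
    rw [isPos_iff] at h3
    constructor <;> linarith

/-! ### Uniqueness of the center and contraction towards it -/

variable [P.IsReduced] [P.IsIrreducible]

/-- Each simple root is at least 1 on `y`, while `θ(y) ≤ h - 1 = ht θ`. As all coefficients of `θ`
are positive, every simple root must equal 1. -/
theorem eq_coweightRho {y : b.coweightLattice}
    (hy : ∀ i, b.IsPos i → 0 < b.rootForm i y ∧ b.rootForm i y < b.coxeterNumber) :
    y = b.coweightRho := by
  obtain ⟨θ, hθ, hθmax, hcox⟩ := b.exists_highestRoot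
  have h1 (j : b.support) : 1 ≤ b.rootForm j y := (hy j (isPos_of_mem_support j.2)).1
  have hc (j : b.support) : 1 ≤ b.rootCoeff θ j := by
    have := hθmax j j
    rwa [rootCoeff_self] at this
  have h2 := (hy θ hθ).2
  rw [hcox, rootForm_eq_sum, height_eq_sum_rootCoeff] at h2
  have h3 : ∑ j, b.rootCoeff θ j * (b.rootForm j y - 1) ≤ 0 := by
    simp only [mul_sub, mul_one, Finset.sum_sub_distrib]
    linarith
  have h4 := (Finset.sum_eq_zero_iff_of_nonneg fun j _ ↦
    mul_nonneg (zero_le_one.trans (hc j)) (sub_nonneg.2 (h1 j))).1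
    (h3.antisymm (Finset.sum_nonneg fun j _ ↦
      mul_nonneg (zero_le_one.trans (hc j)) (sub_nonneg.2 (h1 j))))
  refine b.coweightLattice_ext fun j ↦ ?_
  rw [rootForm_coweightRho, height_one_of_mem_support j.2]
  have h5 := (mul_eq_zero.1 (h4 j (Finset.mem_univ _))).resolve_left (by linarith [hc j])
  linarith

theorem InAlcove.eq_center {κ : ι → ℤ} {σ : Equiv.Perm ι}
    {w : b.coweightLattice ≃+ b.coweightLattice} (hσ : b.IsInducedPerm σ w)
    {t : b.coweightLattice} (hpos : ∀ i, b.IsPos i → κ (σ i) = b.rootForm (σ i) t)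
    {z : b.coweightLattice} (hz : b.InAlcove κ b.coxeterNumber z) :
    z = w b.coweightRho + (b.coxeterNumber : ℤ) • t := by
  rw [← b.eq_coweightRho (y := w.symm (z - (b.coxeterNumber : ℤ) • t))]
  · simp
  · intro i hi
    rw [← hσ i, AddEquiv.apply_symm_apply, map_sub, map_zsmul, smul_eq_mul, ← hpos i hi]
    have := hz (σ i)
    constructor <;> linarith

theorem InAlcove.center_unique {κ : ι → ℤ} {z z' : b.coweightLattice}
    (hz : b.InAlcove κ b.coxeterNumber z) (hz' : b.InAlcove κ b.coxeterNumber z') : z = z' := by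
  obtain ⟨σ, w, hσ, t, hpos, -⟩ :=
    hz.exists_transport b (by exact_mod_cast b.coxeterNumber_pos)
  rw [hz.eq_center b hσ hpos, hz'.eq_center b hσ hpos]

theorem InAlcove.inShiAlcove_sub_smul {κ : ι → ℤ} {q k : ℤ}
    {x z : b.coweightLattice} (hz : b.InAlcove κ b.coxeterNumber z)
    (hx : b.InShiAlcove κ q k x) :
    b.InShiAlcove κ (q - k * b.coxeterNumber) 0 (x - k • z) := by
  have hh : (0 : ℤ) < b.coxeterNumber := by exact_mod_cast b.coxeterNumber_pos
  obtain ⟨σ, w, hσ, t, hpos, hneg⟩ := hz.exists_transport b hh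
  obtain ⟨θ, hθ, hθmax, hcox⟩ := b.exists_highestRoot
  have hzeq := hz.eq_center b hσ hpos
  set m := q - k * b.coxeterNumber with hm
  set y := w.symm (x - k • z - m • t) with hydef
  -- The sign of `α_i(g)` records whether `σ i` is positive, hence which end of the half-open
  -- interval for root `i` is the open one.
  set g := w.symm b.coweightRho with hgdef
  have hg (i) : b.rootForm i g = b.height (σ i) := by
    rw [← hσ, hgdef, AddEquiv.apply_symm_apply, rootForm_coweightRho]
  have hy (i) : b.rootForm i y = b.rootForm (σ i) (x - k • z) - m * b.rootForm (σ i) t := by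
    rw [← hσ, hydef, AddEquiv.apply_symm_apply, map_sub, map_zsmul, smul_eq_mul]
  have hy' (i) (hi : b.IsPos i) :
      b.rootForm i y = b.rootForm (σ i) x - q * κ (σ i) - k * b.height i := by
    rw [hy, hzeq, map_sub, map_zsmul, map_add, hσ, map_zsmul, rootForm_coweightRho, hpos i hi, hm]
    simp only [smul_eq_mul]
    ring
  have hxpos (i) (hi : b.IsPos i) (hgi : 0 < b.rootForm i g) :
      k * (1 - b.height i) < b.rootForm i y ∧ b.rootForm i y ≤ q - k - k * b.height i := by
    rw [hg] at hgi
    have := hx (σ i) hgi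
    rw [hy' i hi]
    constructor <;> linarith
  have hxneg (i) (hi : b.IsPos i) (hgi : b.rootForm i g ≤ 0) :
      k * (1 - b.height i) ≤ b.rootForm i y ∧ b.rootForm i y < q - k - k * b.height i := by
    rw [hg] at hgi
    have := hx (P.reflectionPerm (σ i) (σ i)) ((b.isPos_reflectionPerm_self_iff _).2 hgi.not_gt)
    rw [hz.apply_reflectionPerm_self hh, rootForm_reflectionPerm_self] at this
    rw [hy' i hi]
    constructor <;> linarith
  -- At `θ` and at the simple roots the height-dependent bounds become exactly `m` and 0.
  have hq : q - k - k * b.height θ = m := by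
    rw [hm, hcox]
    ring
  have hone (j : b.support) : k * (1 - b.height j) = 0 := by
    rw [height_one_of_mem_support j.2]
    ring
  have key {i} (hi : b.IsPos i) := b.rootForm_bounds_of_wall_bounds hθmax (m := m) (y := y)
    (g := g)
    (fun j ↦ by
      rw [← hone j]
      rcases le_or_gt (b.rootForm j g) 0 with h | h
      · exact (hxneg j (isPos_of_mem_support j.2) h).1
      · exact (hxpos j (isPos_of_mem_support j.2) h).1.le)
    (fun j h ↦ by
      rw [← hone j]
      exact (hxpos j (isPos_of_mem_support j.2) h).1)
    (by
      rw [← hq]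
      rcases le_or_gt (b.rootForm θ g) 0 with h | h
      · exact (hxneg θ hθ h).2.le
      · exact (hxpos θ hθ h).2)
    (fun h ↦ by
      rw [← hq]
      exact (hxneg θ hθ h).2) hi
  intro a ha
  obtain ⟨i, rfl⟩ := σ.surjective a
  have hform : b.rootForm (σ i) (x - k • z) = b.rootForm i y + m * b.rootForm (σ i) t := by
    linarith [hy i]
  by_cases hi : b.IsPos i
  · have h1 := (key hi).1 (by rwa [hg])
    rw [hform, hpos i hi]
    constructor <;> linarith
  · have h1 := (key ((b.isPos_reflectionPerm_self_iff i).2 hi)).2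
    rw [rootForm_reflectionPerm_self, rootForm_reflectionPerm_self, hg] at h1
    have h2 := h1 (by rw [isPos_iff] at ha; linarith)
    rw [hform, hneg i hi]
    constructor <;> linarith

end RootPairing.Base

/-! ### Counting and quasi-polynomials -/

theorem ModN.mkQ_eq_mkQ_iff {L : Type*} [AddCommGroup L] {n : ℕ} {x y : L} :
    ModN.mkQ n x = ModN.mkQ n y ↔ ∃ v : L, x = y + (n : ℤ) • v := by
  change Submodule.Quotient.mk x = Submodule.Quotient.mk y ↔ _
  rw [Submodule.Quotient.eq]
  simp only [LinearMap.mem_range, LinearMap.lsmul_apply]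
  exact exists_congr fun v ↦ ⟨fun h ↦ by rw [h]; abel, fun h ↦ by rw [h]; abel⟩

theorem ModN.mkQ_surjective {L : Type*} [AddCommGroup L] (n : ℕ) :
    Function.Surjective (ModN.mkQ n : L → ModN L n) :=
  Submodule.mkQ_surjective _

/-- An injection `F` with `F (x + m v) = F x + q v` whose range is the complement of the
arrangement modulo `q` identifies that complement with `L / m L`. -/
theorem ncard_complementMod_eq {L : Type*} [AddCommGroup L] {A : Set (Module.Dual ℤ L × ℤ)}
    {m q : ℕ} {F : L → L} (hF : Function.Injective F)
    (hadd : ∀ x v, F (x + (m : ℤ) • v) = F x + (q : ℤ) • v)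
    (hrange : ∀ x, x ∈ Set.range F ↔ ∀ p ∈ A, ¬ p.1 x ≡ p.2 [ZMOD q]) :
    (complementMod A q).ncard = Nat.card (ModN L m) := by
  let φ : ModN L m → ModN L q := fun y ↦
    ModN.mkQ q (F (Function.surjInv (ModN.mkQ_surjective m) y))
  have hφ (x : L) : φ (ModN.mkQ m x) = ModN.mkQ q (F x) := by
    obtain ⟨v, hv⟩ := ModN.mkQ_eq_mkQ_iff.1
      (Function.surjInv_eq (ModN.mkQ_surjective m) (ModN.mkQ m x))
    simp only [φ, hv, hadd]
    exact ModN.mkQ_eq_mkQ_iff.2 ⟨v, rfl⟩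
  have hinj : Function.Injective φ := by
    intro y y' h
    obtain ⟨x, rfl⟩ := ModN.mkQ_surjective m y
    obtain ⟨x', rfl⟩ := ModN.mkQ_surjective m y'
    rw [hφ, hφ] at h
    obtain ⟨v, hv⟩ := ModN.mkQ_eq_mkQ_iff.1 h
    rw [← hadd] at hv
    exact ModN.mkQ_eq_mkQ_iff.2 ⟨v, hF hv⟩
  have himage : complementMod A q = φ '' Set.univ := by
    ext y
    rw [Set.image_univ]
    constructor
    · intro hy
      obtain ⟨x, rfl⟩ := ModN.mkQ_surjective q y
      obtain ⟨x', rfl⟩ := (hrange x).2 (hy x rfl)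
      exact ⟨ModN.mkQ m x', hφ x'⟩
    · rintro ⟨y, rfl⟩ x hx
      obtain ⟨x', rfl⟩ := ModN.mkQ_surjective m y
      rw [hφ] at hx
      obtain ⟨v, rfl⟩ := ModN.mkQ_eq_mkQ_iff.1 hx
      exact (hrange _).1 ⟨x' + (m : ℤ) • v, hadd x' v⟩
  rw [himage, Set.ncard_image_of_injective _ hinj, Set.ncard_univ]

theorem exists_mem_Icc_modEq {n : ℕ} (hn : 0 < n) (q : ℤ) :
    ∃ r ∈ Finset.Icc 1 n, q ≡ r [ZMOD n] := by
  have hn' : (0 : ℤ) < n := by exact_mod_cast hn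
  have h0 := Int.emod_nonneg (q - 1) hn'.ne'
  have h1 := Int.emod_lt_of_pos (q - 1) hn'
  refine ⟨((q - 1) % n + 1).toNat, Finset.mem_Icc.2 (by lia), ?_⟩
  rw [Int.toNat_of_nonneg (by lia)]
  simpa using ((Int.mod_modEq (q - 1) n).add_right 1).symm

/-- A quasi-polynomial which eventually agrees with a polynomial is this polynomial. -/
theorem IsGcdQuasiPolynomial.eq_eval {f : ℤ → ℤ} (hf : IsGcdQuasiPolynomial f) {p : ℤ[X]}
    {q₀ : ℕ} (h : ∀ q : ℕ, q₀ < q → f q = p.eval (q : ℤ)) (t : ℤ) : f t = p.eval t := by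
  obtain ⟨n, hn, g, hg, -⟩ := hf
  obtain ⟨r, hr, htr⟩ := exists_mem_Icc_modEq hn t
  have hgp : g r = p := by
    refine Polynomial.eq_of_infinite_eval_eq _ _ ?_
    -- Infinitely many points beyond `q₀` in the residue class of `r`, at which `g r` and `p` agree.
    have hinj : Function.Injective fun a : ℕ ↦ ((r + n * (q₀ + a) : ℕ) : ℤ) := by
      intro a a' haa'
      have h1 : r + n * (q₀ + a) = r + n * (q₀ + a') := Nat.cast_injective (R := ℤ) haa'
      have h2 := Nat.eq_of_mul_eq_mul_left hn (Nat.add_left_cancel h1)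
      lia
    refine (Set.infinite_range_of_injective hinj).mono ?_
    rintro _ ⟨a, rfl⟩
    have h1 : q₀ < r + n * (q₀ + a) := by
      have := (Finset.mem_Icc.1 hr).1
      nlinarith
    change (g r).eval _ = p.eval _
    rw [← h _ h1, hg r hr]
    rw [Int.modEq_iff_dvd]
    exact ⟨-(q₀ + a), by push_cast; ring⟩
  rw [hg r hr t htr, hgp]

theorem isGcdQuasiPolynomial_eval (p : ℤ[X]) : IsGcdQuasiPolynomial fun t ↦ p.eval t :=
  ⟨1, one_pos, fun _ ↦ p, fun _ _ _ _ ↦ rfl, fun _ _ _ _ _ ↦ rfl⟩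

/-! ### The bijection and the count -/

namespace RootPairing.Base

variable {ι M N : Type*} [AddCommGroup M] [Module ℝ M] [AddCommGroup N] [Module ℝ N]
  {P : RootPairing ι ℝ M N} (b : P.Base)

theorem forall_mem_truncatedAffineWeylArrangement_iff {a c : ℤ} {q : ℕ} {x : b.coweightLattice} :
    (∀ p ∈ b.truncatedAffineWeylArrangement a c, ¬ p.1 x ≡ p.2 [ZMOD q]) ↔
      ∀ i, b.IsPos i → ∀ j, a ≤ j → j ≤ c → ¬ b.rootForm i x ≡ j [ZMOD q] := by
  constructor
  · intro h i hi j ha hc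
    exact h _ ⟨i, hi, j, ha, hc, rfl⟩
  · rintro h _ ⟨i, hi, j, ha, hc, rfl⟩
    exact h i hi j ha hc

variable {b}

theorem InShiAlcove.eq_of_isPos {κ κ' : ι → ℤ} {n k : ℤ} (hn : 0 < n) (hk : 0 ≤ k)
    {x : b.coweightLattice} (h : b.InShiAlcove κ n k x) (h' : b.InShiAlcove κ' n k x) {i : ι}
    (hi : b.IsPos i) : κ i = κ' i := by
  have h1 := h i hi
  have h2 := h' i hi
  have h3 : κ i < κ' i + 1 := lt_of_mul_lt_mul_left (by linarith) hn.le
  have h4 : κ' i < κ i + 1 := lt_of_mul_lt_mul_left (by linarith) hn.le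
  lia

theorem InAlcove.eq_of_forall_isPos {κ κ' : ι → ℤ} {n n' : ℤ} (hn : 0 < n) (hn' : 0 < n')
    {x x' : b.coweightLattice} (h : b.InAlcove κ n x) (h' : b.InAlcove κ' n' x')
    (hpos : ∀ i, b.IsPos i → κ i = κ' i) : κ = κ' := by
  ext i
  by_cases hi : b.IsPos i
  · exact hpos i hi
  · have h1 := hpos _ ((b.isPos_reflectionPerm_self_iff i).2 hi)
    rw [h.apply_reflectionPerm_self hn, h'.apply_reflectionPerm_self hn'] at h1
    lia

theorem InShiAlcove.add_smul {κ : ι → ℤ} {n k : ℤ} {x : b.coweightLattice}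
    (h : b.InShiAlcove κ n k x) (v : b.coweightLattice) :
    b.InShiAlcove (fun i ↦ κ i + b.rootForm i v) n k (x + n • v) := fun i hi ↦ by
  have := h i hi
  simp only [map_add, map_zsmul, smul_eq_mul]
  constructor <;> linarith

theorem InShiAlcove.not_modEq {κ : ι → ℤ} {q k : ℤ} (hq : 0 < q) {x : b.coweightLattice}
    (h : b.InShiAlcove κ q k x) {i : ι} (hi : b.IsPos i) {j : ℤ} (hj : 1 - k ≤ j) (hj' : j ≤ k) :
    ¬ b.rootForm i x ≡ j [ZMOD q] := fun hmod ↦ by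
  obtain ⟨c, hc⟩ := hmod.dvd
  have h1 := h i hi
  have h2 : κ i < -c := lt_of_mul_lt_mul_left (by linarith) hq.le
  have h3 : -c < κ i + 1 := lt_of_mul_lt_mul_left (by linarith) hq.le
  lia

variable (b)

/-- A point avoiding the extended Shi arrangement modulo `q` lies in some alcove, with the
corresponding margins. -/
theorem exists_inShiAlcove_of_forall_not_modEq {q k : ℤ} (hq : 0 < q) (hk : 0 < k)
    {x : b.coweightLattice}
    (h : ∀ i, b.IsPos i → ∀ j, 1 - k ≤ j → j ≤ k → ¬ b.rootForm i x ≡ j [ZMOD q]) :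
    ∃ κ, b.InAlcove κ q x ∧ b.InShiAlcove κ q k x := by
  have hnd (i) : ¬ q ∣ b.rootForm i x := fun hd ↦ by
    by_cases hi : b.IsPos i
    · exact h i hi 0 (by lia) hk.le (Int.modEq_zero_iff_dvd.2 hd)
    · refine h _ ((b.isPos_reflectionPerm_self_iff i).2 hi) 0 (by lia) hk.le
        (Int.modEq_zero_iff_dvd.2 ?_)
      rw [rootForm_reflectionPerm_self]
      exact hd.neg_right
  have hdiv (i) : b.rootForm i x = q * (b.rootForm i x / q) + b.rootForm i x % q :=
    (Int.mul_ediv_add_emod _ _).symm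
  refine ⟨fun i ↦ b.rootForm i x / q, fun i ↦ ?_, fun i hi ↦ ?_⟩
  · have h1 := Int.emod_lt_of_pos (b.rootForm i x) hq
    have h2 := (Int.emod_nonneg (b.rootForm i x) hq.ne').lt_of_ne'
      fun h0 ↦ hnd i (Int.dvd_of_emod_eq_zero h0)
    have h3 := hdiv i
    constructor <;> linarith
  · have h0 := Int.emod_nonneg (b.rootForm i x) hq.ne'
    have h1 := Int.emod_lt_of_pos (b.rootForm i x) hq
    have h3 := hdiv i
    have h4 : k < b.rootForm i x % q := by
      by_contra! hle
      exact h i hi _ (by lia) hle (Int.mod_modEq _ _).symm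
    -- A residue above `q - k` is congruent to one of `1 - k, …, -1`; this gives the weak upper
    -- bound opposite the strict lower one.
    have h5 : b.rootForm i x % q ≤ q - k := by
      by_contra! hlt
      refine h i hi (b.rootForm i x % q - q) (by lia) (by lia) ?_
      rw [Int.modEq_iff_dvd]
      exact ⟨-(b.rootForm i x / q) - 1, by linarith⟩
    constructor <;> linarith

variable [Fintype ι] [P.IsRootSystem] [P.IsCrystallographic]

/-- The partially closed alcoves cover the space. -/
theorem exists_inShiAlcove_zero {m : ℤ} (hm : 0 < m) (x : b.coweightLattice) :
    ∃ κ z, b.InAlcove κ b.coxeterNumber z ∧ b.InShiAlcove κ m 0 x := by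
  have hh : (0 : ℤ) < b.coxeterNumber := by exact_mod_cast b.coxeterNumber_pos
  classical
  let κ (i : ι) : ℤ := if b.IsPos i then (b.rootForm i x - 1) / m else b.rootForm i x / m
  have hκpos {i} (hi : b.IsPos i) :
      m * κ i + 1 ≤ b.rootForm i x ∧ b.rootForm i x ≤ m * (κ i + 1) := by
    have h1 := Int.mul_ediv_add_emod (b.rootForm i x - 1) m
    have h2 := Int.emod_nonneg (b.rootForm i x - 1) hm.ne'
    have h3 := Int.emod_lt_of_pos (b.rootForm i x - 1) hm
    simp only [κ, if_pos hi]
    constructor <;> linarith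
  have hκneg {i} (hi : ¬ b.IsPos i) :
      m * κ i ≤ b.rootForm i x ∧ b.rootForm i x + 1 ≤ m * (κ i + 1) := by
    have h1 := Int.mul_ediv_add_emod (b.rootForm i x) m
    have h2 := Int.emod_nonneg (b.rootForm i x) hm.ne'
    have h3 := Int.emod_lt_of_pos (b.rootForm i x) hm
    simp only [κ, if_neg hi]
    constructor <;> linarith
  -- Moving `x / m` by `-ρ^∨ / (hm)` changes `α_i(x)` by `-ht(α_i) / h`, of size less than 1, which
  -- pushes it off the closed faces into the open alcove.
  have hin : b.InAlcove κ (b.coxeterNumber * m)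
      ((b.coxeterNumber : ℤ) • x - b.coweightRho) := fun i ↦ by
    rw [map_sub, map_zsmul, smul_eq_mul, rootForm_coweightRho]
    have h1 := b.height_lt_coxeterNumber i
    by_cases hi : b.IsPos i
    · have h2 := mul_le_mul_of_nonneg_left (hκpos hi).1 hh.le
      have h3 := mul_le_mul_of_nonneg_left (hκpos hi).2 hh.le
      rw [isPos_iff] at hi
      constructor <;> linarith
    · have h2 := mul_le_mul_of_nonneg_left (hκneg hi).1 hh.le
      have h3 := mul_le_mul_of_nonneg_left (hκneg hi).2 hh.le
      have h4 := b.height_lt_coxeterNumber (P.reflectionPerm i i)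
      have h5 := (b.isPos_reflectionPerm_self_iff i).2 hi
      have h6 : b.height (P.reflectionPerm i i) = -b.height i := b.height_reflectionPerm_self i
      rw [isPos_iff] at h5
      constructor <;> linarith
  obtain ⟨z, hz⟩ := hin.exists_center b (mul_pos hh hm)
  refine ⟨κ, z, hz, fun i hi ↦ ?_⟩
  have := hκpos hi
  constructor <;> linarith

variable [P.IsReduced] [P.IsIrreducible]

/-- The number of points avoiding the extended Shi arrangement modulo `q`. -/
theorem ncard_complementMod_truncatedAffineWeylArrangement {k : ℤ} (hk : 0 < k) {m q : ℕ}
    (hm : 0 < m) (hq : (q : ℤ) = m + k * b.coxeterNumber) :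
    (complementMod (b.truncatedAffineWeylArrangement (1 - k) k) q).ncard =
      m ^ Module.finrank ℝ M := by
  have hh : (0 : ℤ) < b.coxeterNumber := by exact_mod_cast b.coxeterNumber_pos
  have hm' : (0 : ℤ) < m := by exact_mod_cast hm
  have hq' : (0 : ℤ) < q := by rw [hq]; positivity
  choose κ c hc hκ using b.exists_inShiAlcove_zero hm'
  -- A point determines its address on positive roots, hence on all roots, hence the center.
  -- Injectivity, equivariance and surjectivity of `F` all rest on this.
  have huniq {n l : ℤ} (hn : 0 < n) (hl : 0 ≤ l) {x z z' : b.coweightLattice} {μ μ' : ι → ℤ}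
      (hz : b.InAlcove μ b.coxeterNumber z) (hx : b.InShiAlcove μ n l x)
      (hz' : b.InAlcove μ' b.coxeterNumber z') (hx' : b.InShiAlcove μ' n l x) : z = z' := by
    obtain rfl := hz.eq_of_forall_isPos hh hh hz' fun i hi ↦ hx.eq_of_isPos hn hl hx' hi
    exact hz.center_unique b hz'
  have hF (x) : b.InShiAlcove (κ x) q k (x + k • c x) := by
    rw [hq]
    exact (hc x).inShiAlcove_add_smul b hk.le (hκ x)
  rw [← b.natCard_modN_coweightLattice hm]
  refine ncard_complementMod_eq (F := fun x ↦ x + k • c x) ?_ ?_ fun x ↦ ?_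
  · intro x x' h
    simp only at h
    have h1 := huniq hq' hk.le (hc x) (hF x) (hc x') (h ▸ hF x')
    rw [h1] at h
    exact add_right_cancel h
  · intro x v
    have h1 := huniq hm' le_rfl (hc (x + (m : ℤ) • v)) (hκ _) ((hc x).add_smul v)
      ((hκ x).add_smul v)
    simp only [h1, hq]
    module
  · rw [forall_mem_truncatedAffineWeylArrangement_iff]
    constructor
    · rintro ⟨y, rfl⟩ i hi j hj hj'
      exact (hF y).not_modEq hq' hi hj hj'
    · intro h
      obtain ⟨μ, hμ, hμk⟩ := b.exists_inShiAlcove_of_forall_not_modEq hq' hk h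
      obtain ⟨z, hz⟩ := hμ.exists_center b hq'
      have h1 := hz.inShiAlcove_sub_smul b hμk
      rw [hq, add_sub_cancel_right] at h1
      have h2 := huniq hm' le_rfl (hc (x - k • z)) (hκ _) hz h1
      refine ⟨x - k • z, ?_⟩
      simp only [h2]
      module

end RootPairing.Base

end

theorem theorem4p1 {ι M N : Type*} [Fintype ι] [AddCommGroup M] [Module ℝ M] [AddCommGroup N]
    [Module ℝ N] (P : RootPairing ι ℝ M N) [P.IsRootSystem] [P.IsCrystallographic] [P.IsReduced]
    [P.IsIrreducible] (b : P.Base) (k : ℤ) (hk : 0 < k) (χ : ℤ → ℤ) :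
    IsCharQuasiPolynomial (b.truncatedAffineWeylArrangement (1 - k) k) χ ↔
      χ = fun t : ℤ ↦ (t - k * b.coxeterNumber) ^ Module.finrank ℝ M := by
  let p : ℤ[X] := (X - C (k * b.coxeterNumber : ℤ)) ^ Module.finrank ℝ M
  have hp (t : ℤ) : p.eval t = (t - k * b.coxeterNumber) ^ Module.finrank ℝ M := by simp [p]
  simp only [← hp]
  have hcount (q : ℕ) (hq : (k * b.coxeterNumber).toNat < q) :
      ((complementMod (b.truncatedAffineWeylArrangement (1 - k) k) q).ncard : ℤ) =
        p.eval (q : ℤ) := by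
    obtain ⟨m, hm⟩ : ∃ m : ℕ, (m : ℤ) = q - k * b.coxeterNumber :=
      ⟨(q - k * b.coxeterNumber).toNat, Int.toNat_of_nonneg (by lia)⟩
    rw [b.ncard_complementMod_truncatedAffineWeylArrangement hk (m := m) (by lia) (by lia), hp,
      ← hm]
    norm_cast
  constructor
  · rintro ⟨hχ, q₀, h⟩
    ext t
    refine hχ.eq_eval (q₀ := max q₀ (k * b.coxeterNumber).toNat) (fun q hq ↦ ?_) t
    rw [← h q (by lia), hcount q (by lia)]
  · rintro rfl
    exact ⟨isGcdQuasiPolynomial_eval p, _, hcount⟩
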